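/- Let $A$ be a non-empty set of atoms. Let $\mathcal S_A$ be the set of closed sequential propositional statements given by the grammar $P ::= a \mid \mathsf T \mid \mathsf F \mid \neg P \mid P \wedge P \mid P \vee P$ with $a\in A$, where in this statement $\wedge$ and $\vee$ denote the left-sequential (short-circuit) conjunction and disjunction. Let $\Sigma_{\mathrm{SCL}}(A)$ be the signature consisting of $\wedge$, $\vee$, $\neg$, $\mathsf T$, $\mathsf F$ and the constants $a\in A$. For a set $E$ of equations between terms with variables, $E\vdash s=t$ means that $s=t$ is derivable from $E$ in equational logic (axioms of $E$, reflexivity, symmetry, transitivity, congruence, substitution). $\mathrm{EqFSCL}$ is the set of the following equations over $\Sigma_{\mathrm{SCL}}(A)$: $$\begin{aligned} &\mathsf F=\neg\mathsf T, && x\vee y=\neg(\neg x\wedge\neg y), && \neg\neg x=x, && \mathsf T\wedge x=x,\\ &x\vee\mathsf F=x, && \mathsf F\wedge x=\mathsf F, && (x\wedge y)\wedge z=x\wedge(y\wedge z), && \neg x\wedge\mathsf F=x\wedge\mathsf F, \end{aligned}$$ $$(x\wedge\mathsf F)\vee y=(x\vee\mathsf T)\wedge y,\qquad (x\wedge y)\vee(z\wedge\mathsf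 F)=(x\vee(z\wedge\mathsf F))\wedge(y\vee(z\wedge\mathsf F)).$$ Let $x\triangleleft y\triangleright z$ be Hoare's ternary conditional ("if $y$ then $x$ else $z$"), and let $\mathrm{CP}$ consist of the equations $$x\triangleleft\mathsf T\triangleright y=x,\quad x\triangleleft\mathsf F\triangleright y=y,\quad \mathsf T\triangleleft x\triangleright\mathsf F=x,\quad x\triangleleft(y\triangleleft z\triangleright u)\triangleright v=(x\triangleleft y\triangleright v)\triangleleft z\triangleright(x\triangleleft u\triangleright v).$$ Free short-circuit logic $\mathrm{FSCL}$ is the equational logic over $\Sigma_{\mathrm{SCL}}(A)$ whose axioms are all equations $s=t$ between (possibly open) terms over $\mathsf T,\neg,\wedge$ and the atoms such that $$\mathrm{CP}\cup\{\neg x=\mathsf F\triangleleft x\triangleright\mathsf T,\;\; x\wedge y=y\triangleleft x\triangleright\mathsf F\}\vdash s=t$$ (so the conditional is a hidden operator), together with the defining equations $\mathsf F=\neg\mathsf T$ and $x\vee y=\neg(\neg x\wedge\neg y)$ of $\mathsf F$ and $\vee$. Theorem. For all $P,Q\in\mathcal S_A$, $$\mathrm{EqFSCL}\vdash P=Q\quad\Longleftrightarrow\quad\mathrm{FSCL}\vdash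 P=Q.$$ -/

import Mathlib

namespace ShortCircuit

open FirstOrder FirstOrder.Language

universe u

/-! ## Equational logic

Signatures are Mathlib's first-order languages (without relation symbols), terms are Mathlib's
terms, with variables taken from the countably infinite set `ℕ`. -/

/-- A set of equations between (open) terms over `L`: `E s t` says that `s = t` belongs to it. -/
abbrev Equations (L : FirstOrder.Language.{u, 0}) : Type u := L.Term ℕ → L.Term ℕ → Prop

/-- `Derivable E s t` is `E ⊢ s = t`: the equation `s = t` is derivable from the axioms `E` with
the rules of equational logic. -/
inductive Derivable {L : FirstOrder.Language.{u, 0}} (E : Equations L) : L.Term ℕ → L.Term ℕ → Prop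
  | ax {s t : L.Term ℕ} : E s t → Derivable E s t
  | refl (s : L.Term ℕ) : Derivable E s s
  | symm {s t : L.Term ℕ} : Derivable E s t → Derivable E t s
  | trans {s t v : L.Term ℕ} : Derivable E s t → Derivable E t v → Derivable E s v
  | congr {n : ℕ} (f : L.Functions n) {s t : Fin n → L.Term ℕ} :
      (∀ i, Derivable E (s i) (t i)) → Derivable E (Term.func f s) (Term.func f t)
  | subst {s t : L.Term ℕ} (σ : ℕ → L.Term ℕ) :
      Derivable E s t → Derivable E (s.subst σ) (t.subst σ)

/-- The module operation that makes a signature visible: given axioms `E` over `L'` and a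
signature `L` included in `L'` by `φ`, this is the set of all consequences of `E` that can be
expressed in `L`; the symbols of `L'` outside `L` are hidden. -/
def visibleConsequences {L L' : FirstOrder.Language.{u, 0}} (φ : L →ᴸ L') (E : Equations L') :
    Equations L :=
  fun s t => Derivable E (φ.onTerm s) (φ.onTerm t)

/-! ## The signature of sequential propositional statements and the axiom set EqFSCL -/

/-- The operation symbols `T`, `F`, `a` (for `a ∈ A`), `¬`, and the short-circuit (left-sequential)
conjunction and disjunction. -/
inductive SCLSymbol (A : Type u) : ℕ → Type u
  | tt : SCLSymbol A 0
  | ff : SCLSymbol A 0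
  | atom (a : A) : SCLSymbol A 0
  | neg : SCLSymbol A 1
  | conj : SCLSymbol A 2
  | disj : SCLSymbol A 2

/-- The signature `Σ_SCL(A)`. -/
def sigSCL (A : Type u) : FirstOrder.Language.{u, 0} := ⟨SCLSymbol A, fun _ => Empty⟩

namespace SCL

variable {A : Type u}

/-- Open terms over `Σ_SCL(A)`. -/
abbrev Tm (A : Type u) : Type u := (sigSCL A).Term ℕ

def tt : Tm A := Term.func (L := sigSCL A) SCLSymbol.tt ![]
def ff : Tm A := Term.func (L := sigSCL A) SCLSymbol.ff ![]
def atom (a : A) : Tm A := Term.func (L := sigSCL A) (SCLSymbol.atom a) ![]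
def neg (s : Tm A) : Tm A := Term.func (L := sigSCL A) SCLSymbol.neg ![s]
def conj (s t : Tm A) : Tm A := Term.func (L := sigSCL A) SCLSymbol.conj ![s, t]
def disj (s t : Tm A) : Tm A := Term.func (L := sigSCL A) SCLSymbol.disj ![s, t]

/-- The variables used in the axioms. -/
abbrev x : Tm A := Term.var 0
abbrev y : Tm A := Term.var 1
abbrev z : Tm A := Term.var 2

end SCL

open SCL in
/-- The axiom set EqFSCL. -/
inductive EqFSCL (A : Type u) : Equations (sigSCL A)
  | F1 : EqFSCL A ff (neg tt)
  | F2 : EqFSCL A (disj x y) (neg (conj (neg x) (neg y)))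
  | F3 : EqFSCL A (neg (neg x)) x
  | F4 : EqFSCL A (conj tt x) x
  | F5 : EqFSCL A (disj x ff) x
  | F6 : EqFSCL A (conj ff x) ff
  | F7 : EqFSCL A (conj (conj x y) z) (conj x (conj y z))
  | F8 : EqFSCL A (conj (neg x) ff) (conj x ff)
  | F9 : EqFSCL A (disj (conj x ff) y) (conj (disj x tt) y)
  | F10 : EqFSCL A (disj (conj x y) (conj z ff))
      (conj (disj x (conj z ff)) (disj y (conj z ff)))

/-- Closed sequential propositional statements over `A`:
`P ::= a | T | F | ¬ P | P && P | P || P`. -/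
inductive ClosedStatement (A : Type u) : Type u
  | atom (a : A) : ClosedStatement A
  | tt : ClosedStatement A
  | ff : ClosedStatement A
  | neg (P : ClosedStatement A) : ClosedStatement A
  | conj (P Q : ClosedStatement A) : ClosedStatement A
  | disj (P Q : ClosedStatement A) : ClosedStatement A

/-- A closed statement, viewed as a term over `Σ_SCL(A)`. -/
def ClosedStatement.toTerm {A : Type u} : ClosedStatement A → SCL.Tm A
  | .atom a => SCL.atom a
  | .tt => SCL.tt
  | .ff => SCL.ff
  | .neg P => SCL.neg P.toTerm
  | .conj P Q => SCL.conj P.toTerm Q.toTerm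
  | .disj P Q => SCL.disj P.toTerm Q.toTerm

/-! ## Proposition algebra with the conditional -/

/-- The operation symbols `T`, `F`, `a` (for `a ∈ A`), the ternary conditional, negation and
short-circuit conjunction. -/
inductive CPSymbol (A : Type u) : ℕ → Type u
  | tt : CPSymbol A 0
  | ff : CPSymbol A 0
  | atom (a : A) : CPSymbol A 0
  | cond : CPSymbol A 3
  | neg : CPSymbol A 1
  | conj : CPSymbol A 2

/-- The signature `Σ_CP(A)` enriched with negation and short-circuit conjunction. -/
def sigCP (A : Type u) : FirstOrder.Language.{u, 0} := ⟨CPSymbol A, fun _ => Empty⟩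

namespace CP

variable {A : Type u}

/-- Open terms over the enriched signature. -/
abbrev Tm (A : Type u) : Type u := (sigCP A).Term ℕ

def tt : Tm A := Term.func (L := sigCP A) CPSymbol.tt ![]
def ff : Tm A := Term.func (L := sigCP A) CPSymbol.ff ![]
def neg (s : Tm A) : Tm A := Term.func (L := sigCP A) CPSymbol.neg ![s]
def conj (s t : Tm A) : Tm A := Term.func (L := sigCP A) CPSymbol.conj ![s, t]
/-- `cond s t r` is the conditional `s ◁ t ▷ r`, that is, `if t then s else r`. -/
def cond (s t r : Tm A) : Tm A := Term.func (L := sigCP A) CPSymbol.cond ![s, t, r]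

/-- The variables used in the axioms. -/
abbrev x : Tm A := Term.var 0
abbrev y : Tm A := Term.var 1
abbrev z : Tm A := Term.var 2
abbrev u : Tm A := Term.var 3
abbrev v : Tm A := Term.var 4

end CP

open CP in
/-- The four axioms CP of proposition algebra, together with the defining equations of negation
and of short-circuit conjunction. -/
inductive CPNegConj (A : Type u) : Equations (sigCP A)
  | CP1 : CPNegConj A (cond x tt y) x
  | CP2 : CPNegConj A (cond x ff y) y
  | CP3 : CPNegConj A (cond tt x ff) x
  | CP4 : CPNegConj A (cond x (cond y z u) v) (cond (cond x y v) z (cond x u v))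
  | defNeg : CPNegConj A (neg x) (cond ff x tt)
  | defConj : CPNegConj A (conj x y) (cond y x ff)

/-! ## Free short-circuit logic -/

/-- The visible operation symbols of short-circuit logic: `T`, `¬`, short-circuit conjunction
and the atoms. -/
inductive VisibleSymbol (A : Type u) : ℕ → Type u
  | tt : VisibleSymbol A 0
  | atom (a : A) : VisibleSymbol A 0
  | neg : VisibleSymbol A 1
  | conj : VisibleSymbol A 2

/-- The visible signature `{T, ¬, &&} ∪ A`. -/
def sigVisible (A : Type u) : FirstOrder.Language.{u, 0} := ⟨VisibleSymbol A, fun _ => Empty⟩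

/-- The inclusion of the visible signature in the enriched signature of CP. -/
def visibleToCP (A : Type u) : sigVisible A →ᴸ sigCP A where
  onFunction := fun {_} f => match f with
    | VisibleSymbol.tt => CPSymbol.tt
    | VisibleSymbol.atom a => CPSymbol.atom a
    | VisibleSymbol.neg => CPSymbol.neg
    | VisibleSymbol.conj => CPSymbol.conj
  onRelation := fun {_} r => r

/-- The inclusion of the visible signature in `Σ_SCL(A)`. -/
def visibleToSCL (A : Type u) : sigVisible A →ᴸ sigSCL A where
  onFunction := fun {_} f => match f with
    | VisibleSymbol.tt => SCLSymbol.tt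
    | VisibleSymbol.atom a => SCLSymbol.atom a
    | VisibleSymbol.neg => SCLSymbol.neg
    | VisibleSymbol.conj => SCLSymbol.conj
  onRelation := fun {_} r => r

/-- The module expression SCL: the consequences, in the visible signature, of CP with the
defining equations of negation and short-circuit conjunction. -/
def moduleSCL (A : Type u) : Equations (sigVisible A) :=
  visibleConsequences (visibleToCP A) (CPNegConj A)

open SCL in
/-- Free short-circuit logic over `Σ_SCL(A)`: its axioms are exactly the consequences of the module
expression SCL, and the defining equations of `F` and of short-circuit disjunction, which add
these two symbols to the visible signature. -/
inductive FSCL (A : Type u) : Equations (sigSCL A)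
  | ofModule {s t : (sigVisible A).Term ℕ} : moduleSCL A s t →
      FSCL A ((visibleToSCL A).onTerm s) ((visibleToSCL A).onTerm t)
  | defFalse : FSCL A ff (neg tt)
  | defDisj : FSCL A (disj x y) (neg (conj (neg x) (neg y)))

end ShortCircuit

namespace ShortCircuit

open FirstOrder FirstOrder.Language

universe u

/-! Both theories axiomatize equality of evaluation trees: each derivability holds for closed `P`
and `Q` exactly when `P.tree = Q.tree`. Soundness (`Derivable.tree_eq`) holds because trees, with
leaf replacement as the conditional, satisfy all axioms. Completeness of `FSCL` is short: CP
rewrites every statement to the nested conditional that spells out its tree.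

Completeness of `EqFSCL` is the hard half. In any model, `ofShape` turns a tree into an always false
element. For always false `f` and `g`, the expression `(x ∨ g) ∧ f` acts as "if `x` then `f` else
`g`", so a fragment of the conditional is available (`eval_disj_conj_ofShape`). It helps to bring
each statement to a normal form (`normalForm_eval`): always false, always true, or an always true
prefix followed by a `Star` term. The tree determines the normal form (`NormalForm.value_unique`).
Levi's lemma compares two factorizations of one tree, and two facts of indecomposability make the
overlap trivial: a `Star` tree has no nontrivial always true prefix, and a literal or disjunction is
not a nontrivial conjunction whose second factor has a false leaf. Equal trees thus give equal
values in every model, in particular in the term model. -/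

/-! ## Evaluation trees -/

/-- Binary decision trees with inner nodes labelled by atoms and leaves by truth values. -/
inductive Tree (A : Type u) : Type u
  | leaf (b : Bool) : Tree A
  | node (l : Tree A) (a : A) (r : Tree A) : Tree A

namespace Tree

variable {A : Type u}

/-- Replace the leaves `true` by `Y` and the leaves `false` by `Z`. -/
def subst : Tree A → Tree A → Tree A → Tree A
  | leaf true, Y, _ => Y
  | leaf false, _, Z => Z
  | node l a r, Y, Z => node (l.subst Y Z) a (r.subst Y Z)

@[simp] theorem subst_true (Y Z : Tree A) : (leaf true).subst Y Z = Y := rfl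
@[simp] theorem subst_false (Y Z : Tree A) : (leaf false).subst Y Z = Z := rfl
@[simp] theorem subst_node (l r : Tree A) (a : A) (Y Z : Tree A) :
    (node l a r).subst Y Z = node (l.subst Y Z) a (r.subst Y Z) := rfl

@[simp] theorem subst_subst (X Y Z U V : Tree A) :
    (X.subst Y Z).subst U V = X.subst (Y.subst U V) (Z.subst U V) := by
  induction X with
  | leaf b => cases b <;> rfl
  | node l a r hl hr => simp [hl, hr]

@[simp] theorem subst_leaves (X : Tree A) : X.subst (leaf true) (leaf false) = X := by
  induction X with
  | leaf b => cases b <;> rfl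
  | node l a r hl hr => simp [hl, hr]

/-- Short-circuit conjunction of trees. -/
abbrev and (X Y : Tree A) : Tree A := X.subst Y (leaf false)
/-- Short-circuit disjunction of trees. -/
abbrev or (X Y : Tree A) : Tree A := X.subst (leaf true) Y
/-- Negation of trees. -/
abbrev neg (X : Tree A) : Tree A := X.subst (leaf false) (leaf true)

/-- `Has b X` says that some leaf of `X` is labelled `b`. -/
def Has (b : Bool) : Tree A → Prop
  | leaf c => c = b
  | node l _ r => l.Has b ∨ r.Has b

@[simp] theorem has_leaf (b c : Bool) : (leaf c : Tree A).Has b ↔ c = b := Iff.rfl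
@[simp] theorem has_node (b : Bool) (l r : Tree A) (a : A) :
    (node l a r).Has b ↔ l.Has b ∨ r.Has b := Iff.rfl

@[simp] theorem has_subst (b : Bool) (X Y Z : Tree A) :
    (X.subst Y Z).Has b ↔ (X.Has true ∧ Y.Has b) ∨ (X.Has false ∧ Z.Has b) := by
  induction X with
  | leaf c => cases c <;> simp
  | node l a r hl hr => simp only [subst_node, has_node, hl, hr]; tauto

theorem has_true_or_false (X : Tree A) : X.Has true ∨ X.Has false := by
  induction X with
  | leaf c => cases c <;> simp
  | node l a r hl hr => simp only [has_node]; tauto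

theorem subst_congr_left {X : Tree A} (h : ¬ X.Has true) (Y Y' Z : Tree A) :
    X.subst Y Z = X.subst Y' Z := by
  induction X with
  | leaf c => cases c <;> simp_all
  | node l a r hl hr => simp only [has_node, not_or] at h; simp [hl h.1, hr h.2]

theorem subst_congr_right {X : Tree A} (h : ¬ X.Has false) (Y Z Z' : Tree A) :
    X.subst Y Z = X.subst Y Z' := by
  induction X with
  | leaf c => cases c <;> simp_all
  | node l a r hl hr => simp only [has_node, not_or] at h; simp [hl h.1, hr h.2]

theorem and_eq_self {X : Tree A} (h : ¬ X.Has true) (Y : Tree A) : X.and Y = X := by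
  conv_rhs => rw [← X.subst_leaves]
  exact subst_congr_left h _ _ _

theorem or_eq_self {X : Tree A} (h : ¬ X.Has false) (Y : Tree A) : X.or Y = X := by
  conv_rhs => rw [← X.subst_leaves]
  exact subst_congr_right h _ _ _

theorem neg_and_of_not_has_false {X : Tree A} (h : ¬ X.Has false) (Y : Tree A) :
    (X.and Y).neg = X.and Y.neg := by
  simp only [subst_subst]
  exact subst_congr_right h _ _ _

/-- The number of inner nodes. -/
def size : Tree A → ℕ
  | leaf _ => 0
  | node l _ r => l.size + r.size + 1

@[simp] theorem size_leaf (b : Bool) : (leaf b : Tree A).size = 0 := rfl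
@[simp] theorem size_node (l r : Tree A) (a : A) : (node l a r).size = l.size + r.size + 1 := rfl

/-! ### Cancellation and factorization of trees. -/

theorem size_le_and {Y : Tree A} (h : Y.Has true) (Z : Tree A) : Z.size ≤ (Y.and Z).size := by
  induction Y with
  | leaf c => simp_all
  | node l a r hl hr =>
    rcases h with h | h
    · have := hl h; simp only [and, subst_node, size_node] at *; omega
    · have := hr h; simp only [and, subst_node, size_node] at *; omega

theorem size_le_or {Y : Tree A} (h : Y.Has false) (Z : Tree A) : Z.size ≤ (Y.or Z).size := by
  induction Y with
  | leaf c => simp_all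
  | node l a r hl hr =>
    rcases h with h | h
    · have := hl h; simp only [or, subst_node, size_node] at *; omega
    · have := hr h; simp only [or, subst_node, size_node] at *; omega

theorem size_lt_node_and {l r : Tree A} {a : A} (h : (node l a r).Has true) (Z : Tree A) :
    Z.size < ((node l a r).and Z).size := by
  rcases h with h | h <;> have := size_le_and h Z <;>
    simp only [and, subst_node, size_node] at * <;> omega

theorem size_lt_node_or {l r : Tree A} {a : A} (h : (node l a r).Has false) (Z : Tree A) :
    Z.size < ((node l a r).or Z).size := by
  rcases h with h | h <;> have := size_le_or h Z <;>
    simp only [or, subst_node, size_node] at * <;> omega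

theorem node_and_ne_of_size_le {l r Z Z' : Tree A} {a : A} (hZ : Z.Has true)
    (hs : Z.size ≤ Z'.size) : Z ≠ (node l a r).and Z' := by
  intro h
  have h1 : (node l a r).Has true := by rw [h] at hZ; simp at hZ; simp; tauto
  have h2 := size_lt_node_and h1 Z'
  rw [← h] at h2
  omega

/-- Both trees are descended in parallel. A leaf `true` facing a node would make `Z` strictly larger
than itself. -/
theorem and_right_cancel {Z : Tree A} (hZ : Z.Has true) {W W' : Tree A}
    (h : W.and Z = W'.and Z) : W = W' := by
  have hF : Z ≠ leaf false := by rintro rfl; simp at hZ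
  induction W generalizing W' with
  | leaf c =>
    cases W' with
    | leaf c' => cases c <;> cases c' <;> simp_all
    | node l' a' r' =>
      cases c
      · simp at h
      · exact absurd h (node_and_ne_of_size_le hZ le_rfl)
  | node l a r hl hr =>
    cases W' with
    | leaf c' =>
      cases c'
      · simp at h
      · exact absurd h.symm (node_and_ne_of_size_le hZ le_rfl)
    | node l' a' r' =>
      simp only [and, subst_node, node.injEq] at h
      rw [hl h.1, hr h.2.2, h.2.1]

/-- The size bound forbids `Y` to end in `true` strictly above a leaf of `Y'`, so `Y` extends `Y'`,
and `W` is what hangs below the true leaves of `Y'`. -/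
theorem exists_factor_of_and_eq_and {Y Z Y' Z' : Tree A} (hZ : Z.Has true)
    (hs : Z.size ≤ Z'.size) (h : Y.and Z = Y'.and Z') :
    ∃ W, Y = Y'.and W ∧ (Y'.Has true → Z' = W.and Z) := by
  induction Y' generalizing Y with
  | leaf c =>
    cases c
    · refine ⟨leaf true, ?_, by simp⟩
      cases Y with
      | leaf d => cases d <;> simp_all
      | node => simp at h
    · exact ⟨Y, by simp, fun _ => h.symm⟩
  | node l' a' r' hl hr =>
    cases Y with
    | leaf d =>
      cases d
      · simp at h
      · exact absurd h (node_and_ne_of_size_le hZ hs)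
    | node l a r =>
      simp only [and, subst_node, node.injEq] at h
      obtain ⟨h1, rfl, h2⟩ := h
      obtain ⟨W₁, rfl, hW₁⟩ := hl h1
      obtain ⟨W₂, rfl, hW₂⟩ := hr h2
      -- The subtrees yield separate factors. If both have true leaves, cancelling `Z` identifies
      -- them; otherwise a factor without a true leaf to land on is irrelevant and may be replaced.
      by_cases ht : l'.Has true
      · refine ⟨W₁, ?_, fun _ => hW₁ ht⟩
        by_cases ht' : r'.Has true
        · rw [and_right_cancel hZ ((hW₁ ht).symm.trans (hW₂ ht'))]; rfl
        · simp [subst_congr_left ht' W₁ W₂]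
      · refine ⟨W₂, ?_, fun h => hW₂ (h.resolve_left ht)⟩
        simp [subst_congr_left ht W₁ W₂]

/-- Levi's lemma for the conjunction of trees. -/
theorem levi_and {Y Z Y' Z' : Tree A} (hY : Y.Has true) (hZ : Z.Has true) (hY' : Y'.Has true)
    (hZ' : Z'.Has true) (h : Y.and Z = Y'.and Z') :
    (∃ W, Y = Y'.and W ∧ Z' = W.and Z) ∨ ∃ W, Y' = Y.and W ∧ Z = W.and Z' := by
  rcases le_total Z.size Z'.size with hs | hs
  · obtain ⟨W, h1, h2⟩ := exists_factor_of_and_eq_and hZ hs h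
    exact Or.inl ⟨W, h1, h2 hY'⟩
  · obtain ⟨W, h1, h2⟩ := exists_factor_of_and_eq_and hZ' hs h.symm
    exact Or.inr ⟨W, h1, h2 hY⟩

/-- On a path to a true leaf of `p`, `Y` must stop strictly earlier, since `Z` is not the leaf
`true`. There `Z` is a node of `p` with `c` grafted below, and its false leaf comes from a copy of
`c`. -/
theorem size_lt_of_or_eq_and {p c Y Z : Tree A} (hp : p.Has true) (hZ : Z.Has false)
    (h : p.or c = Y.and Z) : c.size < Z.size := by
  induction p generalizing Y with
  | leaf b =>
    obtain rfl : b = true := hp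
    cases Y with
    | leaf d =>
      cases d
      · simp at h
      · obtain rfl : _ = Z := h
        simp at hZ
    | node => simp at h
  | node l a r hl hr =>
    cases Y with
    | leaf d =>
      cases d
      · simp at h
      · obtain rfl : _ = Z := h
        refine size_lt_node_or ?_ c
        simp at hZ ⊢
        tauto
    | node l' a' r' =>
      simp only [or, and, subst_node, node.injEq] at h
      rcases hp with hp | hp
      · exact hl hp h.1
      · exact hr hp h.2.2

/-- A false leaf of `Y` would lie inside a copy of `c`. That copy is too small to contain `Z`, so it
is a part of `Y` without true leaves, contrary to `hc`. -/
theorem not_has_false_of_or_eq_and {p c Y Z : Tree A} (hc : c.Has true) (hs : c.size < Z.size)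
    (h : p.or c = Y.and Z) : ¬ Y.Has false := by
  induction p generalizing Y with
  | leaf b =>
    cases b
    · have hY : ¬ Y.Has true := fun hY => by
        have := size_le_and hY Z
        simp only [or, subst_false] at h
        rw [← h] at this
        omega
      rw [and_eq_self hY] at h
      obtain rfl : c = Y := h
      exact absurd hc hY
    · cases Y with
      | leaf d => cases d <;> simp at h ⊢
      | node => simp at h
  | node l a r hl hr =>
    cases Y with
    | leaf d => cases d <;> simp at h ⊢
    | node l' a' r' =>
      simp only [or, and, subst_node, node.injEq] at h
      simp [hl h.1, hr h.2.2]

end Tree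

/-! ## Models of EqFSCL -/

/-- Algebras for the signature of short-circuit logic that satisfy the equations of EqFSCL. -/
class SCLAlgebra (A : Type u) (M : Type*) where
  tt : M
  ff : M
  atom : A → M
  neg : M → M
  conj : M → M → M
  disj : M → M → M
  ff_eq : ff = neg tt
  disj_eq (x y : M) : disj x y = neg (conj (neg x) (neg y))
  neg_neg (x : M) : neg (neg x) = x
  tt_conj (x : M) : conj tt x = x
  disj_ff (x : M) : disj x ff = x
  ff_conj (x : M) : conj ff x = ff
  conj_assoc (x y z : M) : conj (conj x y) z = conj x (conj y z)
  neg_conj_ff (x : M) : conj (neg x) ff = conj x ff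
  conj_ff_disj (x y : M) : disj (conj x ff) y = conj (disj x tt) y
  conj_disj_ff (x y z : M) : disj (conj x y) (conj z ff) =
    conj (disj x (conj z ff)) (disj y (conj z ff))

namespace SCLAlgebra

variable (A : Type u) {M : Type*} [SCLAlgebra A M]

local notation "𝐓" => SCLAlgebra.tt A (M := M)
local notation "𝐅" => SCLAlgebra.ff A (M := M)
local prefix:max "∼" => SCLAlgebra.neg A
local infixr:70 " ⋏ " => SCLAlgebra.conj A
local infixr:65 " ⋎ " => SCLAlgebra.disj A

/-! ### Duality and always false elements. -/

theorem neg_ff : ∼𝐅 = 𝐓 := by rw [ff_eq, neg_neg]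
theorem neg_disj (x y : M) : ∼(x ⋎ y) = ∼x ⋏ ∼y := by rw [disj_eq, neg_neg]
theorem neg_conj (x y : M) : ∼(x ⋏ y) = ∼x ⋎ ∼y := by rw [disj_eq, neg_neg, neg_neg]
theorem conj_tt (x : M) : x ⋏ 𝐓 = x := by
  have := disj_ff (A := A) (SCLAlgebra.neg A x)
  rw [disj_eq, neg_neg, neg_ff] at this
  rw [← neg_neg (A := A) (x ⋏ 𝐓), this, neg_neg]
theorem tt_disj (x : M) : 𝐓 ⋎ x = 𝐓 := by
  rw [disj_eq, ← ff_eq, ff_conj, neg_ff]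
theorem ff_disj (x : M) : 𝐅 ⋎ x = x := by
  rw [disj_eq, neg_ff, tt_conj, neg_neg]
theorem neg_disj_tt (x : M) : ∼x ⋎ 𝐓 = x ⋎ 𝐓 := by
  rw [disj_eq, ← ff_eq, neg_conj_ff, disj_eq, ← ff_eq]

/-- The predicate `x = x ∧ F`, satisfied by the elements that always evaluate to false. -/
def IsFalse (f : M) : Prop := f ⋏ 𝐅 = f

variable {A}

theorem IsFalse.conj_eq {f : M} (h : IsFalse A f) (x : M) : f ⋏ x = f := by
  rw [← h, conj_assoc, ff_conj]

theorem IsFalse.neg_conj_ff {f : M} (h : IsFalse A f) : ∼f ⋏ 𝐅 = f := by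
  rw [SCLAlgebra.neg_conj_ff, h]

theorem IsFalse.conj_left {f : M} (h : IsFalse A f) (x : M) : IsFalse A (x ⋏ f) := by
  rw [IsFalse, conj_assoc, h]

theorem isFalse_ff : IsFalse A 𝐅 := ff_conj _

theorem IsFalse.neg_disj_eq {f : M} (h : IsFalse A f) (x : M) : ∼f ⋎ x = ∼f := by
  rw [disj_eq, neg_neg, h.conj_eq]

theorem IsFalse.conj_disj {f : M} (h : IsFalse A f) (x y : M) :
    (x ⋏ y) ⋎ f = (x ⋎ f) ⋏ (y ⋎ f) := by
  rw [← h, conj_disj_ff]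

theorem IsFalse.disj_conj {f : M} (h : IsFalse A f) (x y : M) :
    (x ⋎ y) ⋏ ∼f = (x ⋏ ∼f) ⋎ (y ⋏ ∼f) := by
  have := congrArg (SCLAlgebra.neg A) (h.conj_disj (SCLAlgebra.neg A x) (SCLAlgebra.neg A y))
  simpa only [neg_disj, neg_conj, neg_neg] using this

/-- As `∼f` is always true, negation passes over it; the axiom `conj_ff_disj` trades the conjunction
for a disjunction, whose negation is a conjunction again. -/
theorem IsFalse.neg_neg_conj {f : M} (h : IsFalse A f) (x : M) : ∼(∼f ⋏ x) = ∼f ⋏ ∼x := by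
  have h1 : ∼f = ∼f ⋎ 𝐓 := by rw [h.neg_disj_eq]
  conv_lhs => rw [h1, ← conj_ff_disj, neg_disj, neg_conj, neg_ff, neg_neg, ← neg_disj_tt,
    h.neg_disj_eq]

/-- A conjunction of a case distinction with two elements that are always false. -/
theorem neg_disj_conj_of_isFalse {f g : M} (hf : IsFalse A f) (hg : IsFalse A g) (x : M) :
    (∼x ⋎ g) ⋏ f = (x ⋎ f) ⋏ g := by
  have key (u s : M) : (u ⋎ s) ⋏ 𝐅 = (u ⋎ (s ⋏ 𝐅)) ⋏ 𝐅 := by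
    rw [← SCLAlgebra.neg_conj_ff, ← SCLAlgebra.neg_conj_ff (_ ⋎ (_ ⋏ _)), neg_disj, neg_disj,
      conj_assoc, conj_assoc, SCLAlgebra.neg_conj_ff, SCLAlgebra.neg_conj_ff, conj_assoc, ff_conj]
  -- An always false element `e` equals `∼e ⋏ 𝐅`. After De Morgan, `key` turns `∼f` into `f`, which
  -- then distributes over `x ⋏ ∼g`.
  rw [← (hf.conj_left (_ ⋎ _)).neg_conj_ff, neg_conj, neg_disj, neg_neg, key, hf.neg_conj_ff,
    hf.conj_disj, hg.neg_disj_eq, conj_assoc, hg.neg_conj_ff]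

/-- The always false element with the shape of a given tree. -/
def ofShape (M : Type*) [SCLAlgebra A M] : Tree A → M
  | .leaf _ => SCLAlgebra.ff A
  | .node l a r => (SCLAlgebra.atom a ⋎ ofShape M r) ⋏ ofShape M l

theorem isFalse_ofShape (X : Tree A) : IsFalse A (ofShape M X) := by
  induction X with
  | leaf b => exact isFalse_ff
  | node l a r hl hr => exact hl.conj_left _

theorem ofShape_subst_leaf (X : Tree A) (b c : Bool) :
    ofShape M (X.subst (.leaf b) (.leaf c)) = ofShape M X := by
  induction X with
  | leaf d => cases d <;> rfl
  | node l a r hl hr => simp [ofShape, hl, hr]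

theorem neg_literal {f g : M} (hf : IsFalse A f) (hg : IsFalse A g) (x : M) :
    ∼((x ⋏ ∼f) ⋎ g) = (∼x ⋏ ∼g) ⋎ f := by
  rw [hf.conj_disj, neg_disj, neg_conj, neg_neg, hg.neg_disj_eq]

/-- The value of a closed statement in a model of EqFSCL. -/
def eval (M : Type*) [SCLAlgebra A M] : ClosedStatement A → M
  | .atom a => SCLAlgebra.atom a
  | .tt => SCLAlgebra.tt A
  | .ff => SCLAlgebra.ff A
  | .neg P => ∼(eval M P)
  | .conj P Q => eval M P ⋏ eval M Q
  | .disj P Q => eval M P ⋎ eval M Q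

end SCLAlgebra

/-- The evaluation tree of a closed statement. -/
def ClosedStatement.tree {A : Type u} : ClosedStatement A → Tree A
  | .atom a => .node (.leaf true) a (.leaf false)
  | .tt => .leaf true
  | .ff => .leaf false
  | .neg P => P.tree.neg
  | .conj P Q => P.tree.and Q.tree
  | .disj P Q => P.tree.or Q.tree

/-! ### The conditional on always false elements, and star terms. -/

namespace SCLAlgebra

variable {A : Type u} {M : Type*} [SCLAlgebra A M]

local prefix:max "∼" => SCLAlgebra.neg A
local infixr:70 " ⋏ " => SCLAlgebra.conj A
local infixr:65 " ⋎ " => SCLAlgebra.disj A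

/-- The left side is the conditional on `P` with always false branches: negation of `P` swaps the
branches, and a conjunction nests two conditionals. -/
theorem eval_disj_conj_ofShape (P : ClosedStatement A) (Y Z : Tree A) :
    (eval M P ⋎ ofShape M Z) ⋏ ofShape M Y = ofShape M (P.tree.subst Y Z) := by
  have hneg {x : M} {X : Tree A}
      (h : ∀ Y Z, (x ⋎ ofShape M Z) ⋏ ofShape M Y = ofShape M (X.subst Y Z)) (Y Z : Tree A) :
      (∼x ⋎ ofShape M Z) ⋏ ofShape M Y = ofShape M (X.neg.subst Y Z) := by
    rw [neg_disj_conj_of_isFalse (isFalse_ofShape Y) (isFalse_ofShape Z), h]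
    simp
  have hconj {x x' : M} {X X' : Tree A}
      (h : ∀ Y Z, (x ⋎ ofShape M Z) ⋏ ofShape M Y = ofShape M (X.subst Y Z))
      (h' : ∀ Y Z, (x' ⋎ ofShape M Z) ⋏ ofShape M Y = ofShape M (X'.subst Y Z)) (Y Z : Tree A) :
      ((x ⋏ x') ⋎ ofShape M Z) ⋏ ofShape M Y = ofShape M ((X.and X').subst Y Z) := by
    rw [(isFalse_ofShape Z).conj_disj, conj_assoc, h', h]
    simp
  induction P generalizing Y Z with
  | atom a => rfl
  | tt => rw [eval, tt_disj, tt_conj]; rfl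
  | ff => rw [eval, ff_disj, (isFalse_ofShape Z).conj_eq]; rfl
  | neg P hP => exact hneg hP Y Z
  | conj P Q hP hQ => exact hconj hP hQ Y Z
  | disj P Q hP hQ =>
    rw [eval, disj_eq (eval M P), hneg (hconj (hneg hP) (hneg hQ))]
    simp [ClosedStatement.tree]

/-- Iterated conjunctions and disjunctions of literals followed by constant elements, with their
trees. The index is `true` where no top-level disjunction and `false` where no top-level
conjunction occurs. -/
inductive Star : Bool → Tree A → M → Prop
  | pos (b : Bool) (a : A) {X Y : Tree A} (hX : ¬ X.Has false) (hY : ¬ Y.Has true) :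
      Star b (.node X a Y) ((SCLAlgebra.atom a ⋏ ∼(ofShape M X)) ⋎ ofShape M Y)
  | neg (b : Bool) (a : A) {X Y : Tree A} (hX : ¬ X.Has false) (hY : ¬ Y.Has true) :
      Star b (.node Y a X) ((∼(SCLAlgebra.atom a) ⋏ ∼(ofShape M X)) ⋎ ofShape M Y)
  | conj {b : Bool} {X Y : Tree A} {m m' : M} (h : Star b X m) (h' : Star false Y m') :
      Star true (X.and Y) (m ⋏ m')
  | disj {b : Bool} {X Y : Tree A} {m m' : M} (h : Star b X m) (h' : Star true Y m') :
      Star false (X.or Y) (m ⋎ m')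

/-! ### Indecomposability and uniqueness of star terms. -/

namespace Star

theorem has {b : Bool} {X : Tree A} {m : M} (h : Star b X m) (c : Bool) : X.Has c := by
  induction h with
  | @pos b a X Y hX hY | @neg b a X Y hX hY =>
    have := X.has_true_or_false
    have := Y.has_true_or_false
    cases c <;> simp <;> tauto
  | conj h h' ih ih' | disj h h' ih ih' => cases c <;> simp_all

theorem negation {b : Bool} {X : Tree A} {m : M} (h : Star b X m) : Star (!b) X.neg ∼m := by
  induction h with
  | @pos b a X Y hX hY =>
    rw [neg_literal (isFalse_ofShape X) (isFalse_ofShape Y),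
      ← ofShape_subst_leaf X false true, ← ofShape_subst_leaf Y false true]
    exact Star.neg _ a (by simpa using hY) (by simpa using hX)
  | @neg b a X Y hX hY =>
    rw [neg_literal (isFalse_ofShape X) (isFalse_ofShape Y), neg_neg,
      ← ofShape_subst_leaf X false true, ← ofShape_subst_leaf Y false true]
    exact Star.pos _ a (by simpa using hY) (by simpa using hX)
  | conj h h' ih ih' =>
    rw [neg_conj]
    convert Star.disj ih ih' using 1 <;> simp
  | disj h h' ih ih' =>
    rw [neg_disj]
    convert Star.conj ih ih' using 1 <;> simp

/-- For a conjunction, Levi's lemma moves `Y` into the first factor, since that factor has a false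
leaf and so cannot be a prefix of `Y`. A disjunction is negated first; negation passes over the
always true `Y`. -/
theorem eq_true_of_eq_and {b : Bool} {X : Tree A} {m : M} (h : Star b X m) {Y Z : Tree A}
    (hY : ¬ Y.Has false) (e : X = Y.and Z) : Y = .leaf true := by
  have hYt := Y.has_true_or_false.resolve_right hY
  induction h generalizing Y Z with
  | @pos b a X₁ X₂ h₁ h₂ | @neg b a X₁ X₂ h₁ h₂ =>
    cases Y with
    | leaf c => simp_all
    | node l a' r =>
      simp only [Tree.and, Tree.subst_node, Tree.node.injEq] at e
      obtain ⟨rfl, -, rfl⟩ := e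
      have := l.has_true_or_false
      have := r.has_true_or_false
      have := Z.has_true_or_false
      simp at h₁ h₂ hY
      tauto
  | @conj b X₁ X₂ m₁ m₂ h₁ h₂ ih₁ ih₂ =>
    have hZ : Z.Has true := by
      have := (Star.conj h₁ h₂).has true
      rw [e] at this; simp at this; tauto
    rcases Tree.levi_and (h₁.has _) (h₂.has _) hYt hZ e with ⟨W, hW, -⟩ | ⟨W, rfl, -⟩
    · exact ih₁ hY hW hYt
    · exact absurd (h₁.has false) (by simp at hY; exact hY.2)
  | @disj b X₁ X₂ m₁ m₂ h₁ h₂ ih₁ ih₂ =>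
    have hZ : Z.Has false := by
      have := (Star.disj h₁ h₂).has false
      rw [e] at this; simp at this; tauto
    have e' := congrArg Tree.neg e
    rw [Tree.neg_and_of_not_has_false hY] at e'
    have e'' : X₁.neg.and X₂.neg = Y.and Z.neg := by rw [← e']; simp
    rcases Tree.levi_and (h₁.negation.has _) (h₂.negation.has _) hYt (by simpa using hZ) e''
      with ⟨W, hW, -⟩ | ⟨W, rfl, -⟩
    · refine ih₁ hY (Z := W.neg) ?_ hYt
      rw [← Tree.neg_and_of_not_has_false hY, ← hW]
      simp
    · have := h₁.has true
      simp at hY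
      tauto

/-- It suffices that `Y` has no false leaf, by the previous lemma. For disjunctions, the two size
comparisons between the last disjunct and `Z` give this. -/
theorem eq_true_of_eq_and_of_has_false {X : Tree A} {m : M} (h : Star false X m) {Y Z : Tree A}
    (hZ : Z.Has false) (e : X = Y.and Z) : Y = .leaf true := by
  have hYt : Y.Has true := by
    have := h.has true
    rw [e] at this; simp at this; tauto
  refine h.eq_true_of_eq_and ?_ e
  generalize hb : false = b at h
  induction h with
  | @pos b a X₁ X₂ h₁ h₂ | @neg b a X₁ X₂ h₁ h₂ =>
    cases Y with
    | leaf c => simp_all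
    | node l a' r =>
      simp only [Tree.and, Tree.subst_node, Tree.node.injEq] at e
      obtain ⟨rfl, -, rfl⟩ := e
      have := l.has_true_or_false
      have := r.has_true_or_false
      simp at h₁ h₂ ⊢
      tauto
  | conj => cases hb
  | @disj b X₁ X₂ m₁ m₂ h₁ h₂ =>
    exact Tree.not_has_false_of_or_eq_and (h₂.has true)
      (Tree.size_lt_of_or_eq_and (h₁.has true) hZ e) e

theorem eq_false_of_eq_or_of_has_true {X : Tree A} {m : M} (h : Star true X m) {Y Z : Tree A}
    (hZ : Z.Has true) (e : X = Y.or Z) : Y = .leaf false := by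
  have := h.negation.eq_true_of_eq_and_of_has_false (Y := Y.neg) (Z := Z.neg) (by simpa using hZ)
    (by rw [e]; simp)
  have := congrArg Tree.neg this
  simpa using this

theorem value_unique {b b' : Bool} {X : Tree A} {m m' : M} (h : Star b X m) (h' : Star b' X m') :
    m = m' := by
  induction h generalizing b' m' with
  | @pos b a X₁ X₂ h₁ h₂ =>
    generalize hX : Tree.node X₁ a X₂ = X at h'
    cases h' with
    | pos => cases hX; rfl
    | neg _ _ h₃ => cases hX; exact absurd (X₂.has_true_or_false) (by tauto)
    | @conj b X₃ X₄ _ _ h₃ h₄ =>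
      -- A literal carries either index, so `false` may be chosen here to rule out a conjunction,
      -- and `true` below to rule out a disjunction.
      have := (Star.pos (M := M) false a h₁ h₂).eq_true_of_eq_and_of_has_false (h₄.has _) hX
      simpa [this] using h₃.has false
    | @disj b X₃ X₄ _ _ h₃ h₄ =>
      have := (Star.pos (M := M) true a h₁ h₂).eq_false_of_eq_or_of_has_true (h₄.has _) hX
      simpa [this] using h₃.has true
  | @neg b a X₁ X₂ h₁ h₂ =>
    generalize hX : Tree.node X₂ a X₁ = X at h'
    cases h' with
    | neg => cases hX; rfl
    | pos _ _ h₃ => cases hX; exact absurd (X₂.has_true_or_false) (by tauto)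
    | @conj b X₃ X₄ _ _ h₃ h₄ =>
      have := (Star.neg (M := M) false a h₁ h₂).eq_true_of_eq_and_of_has_false (h₄.has _) hX
      simpa [this] using h₃.has false
    | @disj b X₃ X₄ _ _ h₃ h₄ =>
      have := (Star.neg (M := M) true a h₁ h₂).eq_false_of_eq_or_of_has_true (h₄.has _) hX
      simpa [this] using h₃.has true
  | @conj b X₁ X₂ m₁ m₂ h₁ h₂ ih₁ ih₂ =>
    generalize hX : X₁.and X₂ = X at h'
    cases h' with
    | pos _ _ h₃ h₄ =>
      have := (Star.pos (M := M) false _ h₃ h₄).eq_true_of_eq_and_of_has_false (h₂.has _) hX.symm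
      simpa [this] using h₁.has false
    | neg _ _ h₃ h₄ =>
      have := (Star.neg (M := M) false _ h₃ h₄).eq_true_of_eq_and_of_has_false (h₂.has _) hX.symm
      simpa [this] using h₁.has false
    | @conj b X₃ X₄ _ _ h₃ h₄ =>
      obtain ⟨rfl, rfl⟩ : X₁ = X₃ ∧ X₂ = X₄ := by
        -- The overlap `W` is a first factor of a last conjunct, which is indecomposable, so `W` is
        -- the leaf `true`.
        rcases Tree.levi_and (h₁.has _) (h₂.has _) (h₃.has _) (h₄.has _) hX with
          ⟨W, e₁, e₂⟩ | ⟨W, e₁, e₂⟩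
        · obtain rfl := h₄.eq_true_of_eq_and_of_has_false (h₂.has _) e₂
          simp_all
        · obtain rfl := h₂.eq_true_of_eq_and_of_has_false (h₄.has _) e₂
          simp_all
      rw [ih₁ h₃, ih₂ h₄]
    | @disj b X₃ X₄ _ _ h₃ h₄ =>
      have := (Star.disj h₃ h₄).eq_true_of_eq_and_of_has_false (h₂.has _) hX.symm
      simpa [this] using h₁.has false
  | @disj b X₁ X₂ m₁ m₂ h₁ h₂ ih₁ ih₂ =>
    generalize hX : X₁.or X₂ = X at h'
    cases h' with
    | pos _ _ h₃ h₄ =>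
      have := (Star.pos (M := M) true _ h₃ h₄).eq_false_of_eq_or_of_has_true (h₂.has _) hX.symm
      simpa [this] using h₁.has true
    | neg _ _ h₃ h₄ =>
      have := (Star.neg (M := M) true _ h₃ h₄).eq_false_of_eq_or_of_has_true (h₂.has _) hX.symm
      simpa [this] using h₁.has true
    | @conj b X₃ X₄ _ _ h₃ h₄ =>
      have := (Star.conj h₃ h₄).eq_false_of_eq_or_of_has_true (h₂.has _) hX.symm
      simpa [this] using h₁.has true
    | @disj b X₃ X₄ _ _ h₃ h₄ =>
      obtain ⟨rfl, rfl⟩ : X₁ = X₃ ∧ X₂ = X₄ := by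
        have hX' : X₁.neg.and X₂.neg = X₃.neg.and X₄.neg := by
          simpa using congrArg Tree.neg hX
        have inj {U V : Tree A} (e : U.neg = V.neg) : U = V := by
          simpa using congrArg Tree.neg e
        rcases Tree.levi_and (h₁.negation.has _) (h₂.negation.has _) (h₃.negation.has _)
          (h₄.negation.has _) hX' with ⟨W, e₁, e₂⟩ | ⟨W, e₁, e₂⟩
        · obtain rfl := h₄.negation.eq_true_of_eq_and_of_has_false (h₂.negation.has _) e₂
          exact ⟨inj (by simpa using e₁), inj (by simpa using e₂.symm)⟩
        · obtain rfl := h₂.negation.eq_true_of_eq_and_of_has_false (h₄.negation.has _) e₂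
          exact ⟨inj (by simpa using e₁.symm), inj (by simpa using e₂)⟩
      rw [ih₁ h₃, ih₂ h₄]

end Star

end SCLAlgebra

/-- A closed statement for the always false element with the shape of a given tree. -/
def Tree.toStatement {A : Type u} : Tree A → ClosedStatement A
  | .leaf _ => .ff
  | .node l a r => .conj (.disj (.atom a) r.toStatement) l.toStatement

theorem Tree.tree_toStatement {A : Type u} (X : Tree A) :
    X.toStatement.tree = X.subst (.leaf false) (.leaf false) := by
  induction X with
  | leaf b => cases b <;> rfl
  | node l a r hl hr => simp [toStatement, ClosedStatement.tree, hl, hr]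

/-! ### Existence and uniqueness of normal forms. -/

namespace SCLAlgebra

variable {A : Type u} {M : Type*} [SCLAlgebra A M]

local prefix:max "∼" => SCLAlgebra.neg A
local infixr:70 " ⋏ " => SCLAlgebra.conj A
local infixr:65 " ⋎ " => SCLAlgebra.disj A

theorem eval_toStatement (X : Tree A) : eval M X.toStatement = ofShape M X := by
  induction X with
  | leaf b => rfl
  | node l a r hl hr => simp [Tree.toStatement, eval, ofShape, hl, hr]

theorem eval_conj_ofShape (P : ClosedStatement A) (Y : Tree A) :
    eval M P ⋏ ofShape M Y = ofShape M (P.tree.and Y) := by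
  rw [← eval_disj_conj_ofShape, ofShape, disj_ff]

theorem neg_ofShape_conj_ofShape (X Y : Tree A) :
    ∼(ofShape M X) ⋏ ofShape M Y = ofShape M (X.subst Y Y) := by
  have := eval_conj_ofShape (M := M) X.toStatement.neg Y
  simpa [eval, eval_toStatement, ClosedStatement.tree, Tree.tree_toStatement] using this

theorem neg_ofShape_conj_neg_ofShape {X : Tree A} (hX : ¬ X.Has false) (Y : Tree A) :
    ∼(ofShape M X) ⋏ ∼(ofShape M Y) = ∼(ofShape M (X.and Y)) := by
  rw [← (isFalse_ofShape X).neg_neg_conj, neg_ofShape_conj_ofShape,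
    Tree.subst_congr_right hX Y Y (.leaf false)]

namespace Star

/-- A trailing always true factor is absorbed by the literals: it goes into the last conjunct, and
into both disjuncts by distributivity. -/
theorem conj_neg_ofShape {b : Bool} {X : Tree A} {m : M} (h : Star b X m) {t : Tree A}
    (ht : ¬ t.Has false) : Star b (X.and t) (m ⋏ ∼(ofShape M t)) := by
  induction h with
  | @pos b a X Y hX hY =>
    rw [(isFalse_ofShape t).disj_conj, conj_assoc, neg_ofShape_conj_neg_ofShape hX,
      (isFalse_ofShape Y).conj_eq]
    convert Star.pos b a (X := X.and t) (by simp; tauto) hY using 1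
    simp [Tree.and_eq_self hY]
  | @neg b a X Y hX hY =>
    rw [(isFalse_ofShape t).disj_conj, conj_assoc, neg_ofShape_conj_neg_ofShape hX,
      (isFalse_ofShape Y).conj_eq]
    convert Star.neg b a (X := X.and t) (by simp; tauto) hY using 1
    simp [Tree.and_eq_self hY]
  | conj h h' ih ih' =>
    rw [conj_assoc]
    convert Star.conj h ih' using 1
    simp
  | disj h h' ih ih' =>
    rw [(isFalse_ofShape t).disj_conj]
    convert Star.disj ih ih' using 1
    simp [Tree.or_eq_self ht]

theorem conjunction {b b' : Bool} {X Y : Tree A} {m m' : M} (h : Star b X m)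
    (h' : Star b' Y m') : Star true (X.and Y) (m ⋏ m') := by
  induction h' with
  | pos b a hX hY => exact h.conj (.pos false a hX hY)
  | neg b a hX hY => exact h.conj (.neg false a hX hY)
  | conj h₁ h₂ ih₁ ih₂ =>
    rw [← conj_assoc]
    convert ih₁.conj h₂ using 1
    simp
  | disj h₁ h₂ ih₁ ih₂ => exact h.conj (h₁.disj h₂)

end Star

/-- Normal forms, together with their trees. -/
inductive NormalForm : Tree A → M → Prop
  | allFalse {X : Tree A} (h : ¬ X.Has true) : NormalForm X (ofShape M X)
  | allTrue {X : Tree A} (h : ¬ X.Has false) : NormalForm X ∼(ofShape M X)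
  | mixed {t X : Tree A} {b : Bool} {m : M} (ht : ¬ t.Has false) (h : Star b X m) :
      NormalForm (t.and X) (∼(ofShape M t) ⋏ m)

theorem NormalForm.negation {X : Tree A} {m : M} (h : NormalForm X m) : NormalForm X.neg ∼m := by
  cases h with
  | allFalse h =>
    rw [← ofShape_subst_leaf X false true]
    exact .allTrue (by simpa using h)
  | allTrue h =>
    rw [← ofShape_subst_leaf X false true, neg_neg]
    exact .allFalse (by simpa using h)
  | mixed ht h =>
    rw [(isFalse_ofShape _).neg_neg_conj, Tree.neg_and_of_not_has_false ht]
    exact .mixed ht h.negation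

theorem NormalForm.conjunction {P Q : ClosedStatement A} (hP : NormalForm P.tree (eval M P))
    (hQ : NormalForm Q.tree (eval M Q)) :
    NormalForm (P.conj Q).tree (eval M (P.conj Q)) := by
  simp only [ClosedStatement.tree, eval]
  have hPF := eval_conj_ofShape (M := M) P
  generalize P.tree = X at *
  generalize Q.tree = Y at *
  generalize eval M P = m at *
  generalize eval M Q = m' at *
  cases hP with
  | allFalse h =>
    rw [(isFalse_ofShape _).conj_eq, Tree.and_eq_self h]
    exact .allFalse h
  | allTrue h =>
    cases hQ with
    -- Before an always false element, only the tree of the left conjunct matters.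
    | allFalse h' => rw [hPF]; exact .allFalse (by simp; tauto)
    | allTrue h' =>
      rw [neg_ofShape_conj_neg_ofShape h]
      exact .allTrue (by simp; tauto)
    | mixed ht' h' =>
      rw [← conj_assoc, neg_ofShape_conj_neg_ofShape h]
      convert NormalForm.mixed _ h' using 1
      · simp
      · simp; tauto
  | mixed ht h =>
    cases hQ with
    | allFalse h' => rw [hPF]; exact .allFalse (by simp at h' ⊢; tauto)
    | allTrue h' =>
      rw [conj_assoc]
      convert NormalForm.mixed ht (h.conj_neg_ofShape h') using 1
      simp
    | mixed ht' h' =>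
      convert NormalForm.mixed ht ((h.conj_neg_ofShape ht').conjunction h') using 1
      · simp
      · simp only [conj_assoc]

theorem normalForm_eval (P : ClosedStatement A) : NormalForm P.tree (eval M P) := by
  induction P with
  | atom a =>
    have h : Star true (.node (.leaf true) a (.leaf false)) _ :=
      Star.pos (A := A) (M := M) true a (by simp) (by simp)
    have := NormalForm.mixed (t := .leaf true) (by simp) h
    simp only [Tree.subst_true, ofShape, neg_ff, tt_conj, conj_tt, disj_ff] at this
    exact this
  | tt =>
    have := NormalForm.allTrue (A := A) (M := M) (X := .leaf true) (by simp)
    rwa [ofShape, neg_ff] at this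
  | ff => exact .allFalse (X := .leaf false) (by simp)
  | neg P hP => exact hP.negation
  | conj P Q hP hQ => exact hP.conjunction hQ
  | disj P Q hP hQ =>
    have := (NormalForm.conjunction (P := P.neg) (Q := Q.neg) hP.negation hQ.negation).negation
    simpa [ClosedStatement.tree, eval, ← disj_eq] using this

theorem NormalForm.value_unique {X : Tree A} {m m' : M} (h : NormalForm X m)
    (h' : NormalForm X m') : m = m' := by
  cases h with
  | allFalse h =>
    cases h' with
    | allFalse => rfl
    | allTrue h' => exact absurd X.has_true_or_false (by tauto)
    | @mixed t _ _ _ ht h' =>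
      have := h'.has true
      have := t.has_true_or_false
      simp at h
      tauto
  | allTrue h =>
    cases h' with
    | allFalse h' => exact absurd X.has_true_or_false (by tauto)
    | allTrue h' => rfl
    | @mixed t _ _ _ ht h' =>
      have := h'.has false
      have := t.has_true_or_false
      simp at h
      tauto
  | @mixed t Y b m ht hY =>
    generalize hX : t.and Y = X at h'
    have hYt := hY.has true
    have hYf := hY.has false
    have htt := t.has_true_or_false.resolve_right ht
    cases h' with
    | allFalse h' => rw [← hX] at h'; simp at h'; tauto
    | allTrue h' => rw [← hX] at h'; simp at h'; tauto
    | @mixed t' Y' _ _ ht' hY' =>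
      have htt' := t'.has_true_or_false.resolve_right ht'
      obtain ⟨rfl, rfl⟩ : t = t' ∧ Y = Y' := by
        -- The overlap `W` inherits from the prefixes that it has no false leaf, so as a prefix of a
        -- star tree it is trivial.
        rcases Tree.levi_and htt hYt htt' (hY'.has _) hX with ⟨W, e₁, e₂⟩ | ⟨W, e₁, e₂⟩
        · rw [e₁] at ht
          obtain rfl := hY'.eq_true_of_eq_and (by simp at ht; tauto) e₂
          simp_all
        · rw [e₁] at ht'
          obtain rfl := hY.eq_true_of_eq_and (by simp at ht'; tauto) e₂
          simp_all
      rw [hY.value_unique hY']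

theorem eval_eq_of_tree_eq (M : Type*) [SCLAlgebra A M] {P Q : ClosedStatement A}
    (h : P.tree = Q.tree) : eval M P = eval M Q :=
  (normalForm_eval P).value_unique (h ▸ normalForm_eval Q)

end SCLAlgebra

/-! ## Derivability -/

namespace Derivable

theorem realize_eq {L : FirstOrder.Language.{u, 0}} {E : Equations L} (N : Type*) [L.Structure N]
    (hE : ∀ s t, E s t → ∀ v : ℕ → N, s.realize v = t.realize v) {s t : L.Term ℕ}
    (h : Derivable E s t) (v : ℕ → N) : s.realize v = t.realize v := by
  induction h generalizing v with
  | ax h => exact hE _ _ h v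
  | refl => rfl
  | symm _ ih => exact (ih v).symm
  | trans _ _ ih₁ ih₂ => exact (ih₁ v).trans (ih₂ v)
  | congr f _ ih => simp [Term.realize, ih]
  | subst σ _ ih => simp only [Term.realize_subst, ih]

end Derivable

/-! ### Soundness of both theories in the model of trees. -/

section TreeModel

variable {A : Type u}

instance : (sigSCL A).Structure (Tree A) where
  funMap := fun {_} f => match f with
    | SCLSymbol.tt => fun _ => .leaf true
    | SCLSymbol.ff => fun _ => .leaf false
    | SCLSymbol.atom a => fun _ => .node (.leaf true) a (.leaf false)
    | SCLSymbol.neg => fun w => (w 0).neg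
    | SCLSymbol.conj => fun w => (w 0).and (w 1)
    | SCLSymbol.disj => fun w => (w 0).or (w 1)
  RelMap := fun r => r.elim

instance : (sigCP A).Structure (Tree A) where
  funMap := fun {_} f => match f with
    | CPSymbol.tt => fun _ => .leaf true
    | CPSymbol.ff => fun _ => .leaf false
    | CPSymbol.atom a => fun _ => .node (.leaf true) a (.leaf false)
    | CPSymbol.cond => fun w => (w 1).subst (w 0) (w 2)
    | CPSymbol.neg => fun w => (w 0).neg
    | CPSymbol.conj => fun w => (w 0).and (w 1)
  RelMap := fun r => r.elim

theorem realize_toTerm (P : ClosedStatement A) (v : ℕ → Tree A) :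
    P.toTerm.realize v = P.tree := by
  induction P with
  | atom a => rfl
  | tt => rfl
  | ff => rfl
  | neg P hP => rw [ClosedStatement.tree, ← hP]; rfl
  | conj P Q hP hQ => rw [ClosedStatement.tree, ← hP, ← hQ]; rfl
  | disj P Q hP hQ => rw [ClosedStatement.tree, ← hP, ← hQ]; rfl

section

variable (s t : SCL.Tm A) (v : ℕ → Tree A)

theorem SCL.realize_tt : (SCL.tt : SCL.Tm A).realize v = .leaf true := rfl
theorem SCL.realize_ff : (SCL.ff : SCL.Tm A).realize v = .leaf false := rfl
theorem SCL.realize_neg : (SCL.neg s).realize v = (s.realize v).neg := rfl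
theorem SCL.realize_conj : (SCL.conj s t).realize v = (s.realize v).and (t.realize v) := rfl
theorem SCL.realize_disj : (SCL.disj s t).realize v = (s.realize v).or (t.realize v) := rfl

end

section

variable (s t r : CP.Tm A) (v : ℕ → Tree A)

theorem CP.realize_tt : (CP.tt : CP.Tm A).realize v = .leaf true := rfl
theorem CP.realize_ff : (CP.ff : CP.Tm A).realize v = .leaf false := rfl
theorem CP.realize_neg : (CP.neg s).realize v = (s.realize v).neg := rfl
theorem CP.realize_conj : (CP.conj s t).realize v = (s.realize v).and (t.realize v) := rfl
theorem CP.realize_cond :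
    (CP.cond s t r).realize v = (t.realize v).subst (s.realize v) (r.realize v) := rfl

end

theorem EqFSCL.realize_eq {s t : (sigSCL A).Term ℕ} (h : EqFSCL A s t) (v : ℕ → Tree A) :
    s.realize v = t.realize v := by
  cases h <;> simp [SCL.realize_tt, SCL.realize_ff, SCL.realize_neg, SCL.realize_conj,
    SCL.realize_disj]

theorem CPNegConj.realize_eq {s t : (sigCP A).Term ℕ} (h : CPNegConj A s t) (v : ℕ → Tree A) :
    s.realize v = t.realize v := by
  cases h <;> simp [CP.realize_tt, CP.realize_ff, CP.realize_neg, CP.realize_conj,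
    CP.realize_cond]

theorem realize_visibleToSCL (s : (sigVisible A).Term ℕ) (v : ℕ → Tree A) :
    ((visibleToSCL A).onTerm s).realize v = ((visibleToCP A).onTerm s).realize v := by
  induction s with
  | var => rfl
  | func f ts ih =>
    cases f with
    | tt => rfl
    | atom a => rfl
    | neg => exact congrArg Tree.neg (ih 0)
    | conj => exact congrArg₂ Tree.and (ih 0) (ih 1)

theorem FSCL.realize_eq {s t : (sigSCL A).Term ℕ} (h : FSCL A s t) (v : ℕ → Tree A) :
    s.realize v = t.realize v := by
  cases h with
  | ofModule h =>
    rw [realize_visibleToSCL, realize_visibleToSCL]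
    exact Derivable.realize_eq _ (fun _ _ => CPNegConj.realize_eq) h v
  | defFalse => simp [SCL.realize_tt, SCL.realize_ff, SCL.realize_neg]
  | defDisj => simp [SCL.realize_neg, SCL.realize_conj, SCL.realize_disj]

end TreeModel

theorem Derivable.tree_eq {A : Type u} {E : Equations (sigSCL A)}
    (hE : ∀ s t, E s t → ∀ v : ℕ → Tree A, s.realize v = t.realize v) {P Q : ClosedStatement A}
    (h : Derivable E P.toTerm Q.toTerm) : P.tree = Q.tree := by
  -- The assignment is arbitrary, since closed statements contain no variables.
  have := Derivable.realize_eq _ hE h fun _ => .leaf true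
  rwa [realize_toTerm, realize_toTerm] at this

/-! ### Congruence and substitution for the individual symbols. -/

section Congruence

variable {A : Type u}

theorem SCL.derivable_neg {E : Equations (sigSCL A)} {s s' : SCL.Tm A} (h : Derivable E s s') :
    Derivable E (SCL.neg s) (SCL.neg s') :=
  Derivable.congr (L := sigSCL A) SCLSymbol.neg (Fin.forall_fin_one.2 h)

theorem SCL.derivable_conj {E : Equations (sigSCL A)} {s s' t t' : SCL.Tm A}
    (h : Derivable E s s') (h' : Derivable E t t') :
    Derivable E (SCL.conj s t) (SCL.conj s' t') :=
  Derivable.congr (L := sigSCL A) SCLSymbol.conj (Fin.forall_fin_two.2 ⟨h, h'⟩)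

theorem SCL.derivable_disj {E : Equations (sigSCL A)} {s s' t t' : SCL.Tm A}
    (h : Derivable E s s') (h' : Derivable E t t') :
    Derivable E (SCL.disj s t) (SCL.disj s' t') :=
  Derivable.congr (L := sigSCL A) SCLSymbol.disj (Fin.forall_fin_two.2 ⟨h, h'⟩)

theorem CP.derivable_cond {E : Equations (sigCP A)} {s s' t t' r r' : CP.Tm A}
    (hs : Derivable E s s') (ht : Derivable E t t') (hr : Derivable E r r') :
    Derivable E (CP.cond s t r) (CP.cond s' t' r') :=
  Derivable.congr (L := sigCP A) CPSymbol.cond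
    (by simpa [Fin.forall_fin_succ] using ⟨hs, ht, hr⟩)

section

variable (σ : ℕ → SCL.Tm A)

theorem SCL.tt_subst : (SCL.tt : SCL.Tm A).subst σ = SCL.tt :=
  congrArg (Term.func _) (by ext i; exact i.elim0)

theorem SCL.ff_subst : (SCL.ff : SCL.Tm A).subst σ = SCL.ff :=
  congrArg (Term.func _) (by ext i; exact i.elim0)

theorem SCL.neg_subst (s : SCL.Tm A) : (SCL.neg s).subst σ = SCL.neg (s.subst σ) :=
  congrArg (Term.func _) (funext (Fin.forall_fin_one.2 rfl))

theorem SCL.conj_subst (s t : SCL.Tm A) :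
    (SCL.conj s t).subst σ = SCL.conj (s.subst σ) (t.subst σ) :=
  congrArg (Term.func _) (funext (Fin.forall_fin_two.2 ⟨rfl, rfl⟩))

theorem SCL.disj_subst (s t : SCL.Tm A) :
    (SCL.disj s t).subst σ = SCL.disj (s.subst σ) (t.subst σ) :=
  congrArg (Term.func _) (funext (Fin.forall_fin_two.2 ⟨rfl, rfl⟩))

end

section

variable (σ : ℕ → CP.Tm A)

theorem CP.tt_subst : (CP.tt : CP.Tm A).subst σ = CP.tt :=
  congrArg (Term.func _) (by ext i; exact i.elim0)

theorem CP.ff_subst : (CP.ff : CP.Tm A).subst σ = CP.ff :=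
  congrArg (Term.func _) (by ext i; exact i.elim0)

theorem CP.neg_subst (s : CP.Tm A) : (CP.neg s).subst σ = CP.neg (s.subst σ) :=
  congrArg (Term.func _) (funext (Fin.forall_fin_one.2 rfl))

theorem CP.conj_subst (s t : CP.Tm A) :
    (CP.conj s t).subst σ = CP.conj (s.subst σ) (t.subst σ) :=
  congrArg (Term.func _) (funext (Fin.forall_fin_two.2 ⟨rfl, rfl⟩))

theorem CP.cond_subst (s t r : CP.Tm A) :
    (CP.cond s t r).subst σ = CP.cond (s.subst σ) (t.subst σ) (r.subst σ) :=
  congrArg (Term.func _) (by ext i; fin_cases i <;> rfl)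

end

end Congruence

/-- The substitution that lists the given terms and is constant from then on. -/
def listSubst {L : FirstOrder.Language.{u, 0}} (s : L.Term ℕ) (l : List (L.Term ℕ)) (n : ℕ) :
    L.Term ℕ :=
  l.getD n s

/-! ## The term model of EqFSCL -/

section TermModel

variable {A : Type u}

/-- Provable equality of terms. -/
def derivableSetoid {L : FirstOrder.Language.{u, 0}} (E : Equations L) : Setoid (L.Term ℕ) where
  r := Derivable E
  iseqv := ⟨.refl, .symm, .trans⟩

/-- Terms modulo provable equality in EqFSCL. -/
abbrev TermModel (A : Type u) : Type u := Quotient (derivableSetoid (EqFSCL A))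

/-- The default value `r` of `listSubst` serves as the instance of the third variable. -/
theorem EqFSCL.derivable_subst {s t : SCL.Tm A} (h : EqFSCL A s t) (p q r : SCL.Tm A) :
    Derivable (EqFSCL A) (s.subst (listSubst r [p, q])) (t.subst (listSubst r [p, q])) :=
  .subst _ (.ax h)

instance : SCLAlgebra A (TermModel A) where
  tt := Quotient.mk _ SCL.tt
  ff := Quotient.mk _ SCL.ff
  atom a := Quotient.mk _ (SCL.atom a)
  neg := Quotient.map SCL.neg fun _ _ => SCL.derivable_neg
  conj := Quotient.map₂ SCL.conj fun _ _ h _ _ h' => SCL.derivable_conj h h'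
  disj := Quotient.map₂ SCL.disj fun _ _ h _ _ h' => SCL.derivable_disj h h'
  ff_eq := Quotient.sound (.ax .F1)
  disj_eq := by
    rintro ⟨p⟩ ⟨q⟩
    have := EqFSCL.F2.derivable_subst p q q
    simp only [SCL.neg_subst, SCL.conj_subst, SCL.disj_subst] at this
    exact Quotient.sound this
  neg_neg := by
    rintro ⟨p⟩
    have := EqFSCL.F3.derivable_subst p p p
    simp only [SCL.neg_subst] at this
    exact Quotient.sound this
  tt_conj := by
    rintro ⟨p⟩
    have := EqFSCL.F4.derivable_subst p p p
    simp only [SCL.conj_subst, SCL.tt_subst] at this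
    exact Quotient.sound this
  disj_ff := by
    rintro ⟨p⟩
    have := EqFSCL.F5.derivable_subst p p p
    simp only [SCL.disj_subst, SCL.ff_subst] at this
    exact Quotient.sound this
  ff_conj := by
    rintro ⟨p⟩
    have := EqFSCL.F6.derivable_subst p p p
    simp only [SCL.conj_subst, SCL.ff_subst] at this
    exact Quotient.sound this
  conj_assoc := by
    rintro ⟨p⟩ ⟨q⟩ ⟨r⟩
    have := EqFSCL.F7.derivable_subst p q r
    simp only [SCL.conj_subst] at this
    exact Quotient.sound this
  neg_conj_ff := by
    rintro ⟨p⟩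
    have := EqFSCL.F8.derivable_subst p p p
    simp only [SCL.conj_subst, SCL.neg_subst, SCL.ff_subst] at this
    exact Quotient.sound this
  conj_ff_disj := by
    rintro ⟨p⟩ ⟨q⟩
    have := EqFSCL.F9.derivable_subst p q q
    simp only [SCL.conj_subst, SCL.disj_subst, SCL.tt_subst, SCL.ff_subst] at this
    exact Quotient.sound this
  conj_disj_ff := by
    rintro ⟨p⟩ ⟨q⟩ ⟨r⟩
    have := EqFSCL.F10.derivable_subst p q r
    simp only [SCL.conj_subst, SCL.disj_subst, SCL.ff_subst] at this
    exact Quotient.sound this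

theorem eval_termModel (P : ClosedStatement A) :
    SCLAlgebra.eval (TermModel A) P = Quotient.mk _ P.toTerm := by
  induction P with
  | atom a => rfl
  | tt => rfl
  | ff => rfl
  | neg P hP => rw [SCLAlgebra.eval, hP]; rfl
  | conj P Q hP hQ => rw [SCLAlgebra.eval, hP, hQ]; rfl
  | disj P Q hP hQ => rw [SCLAlgebra.eval, hP, hQ]; rfl

theorem EqFSCL.derivable_of_tree_eq {P Q : ClosedStatement A} (h : P.tree = Q.tree) :
    Derivable (EqFSCL A) P.toTerm Q.toTerm := by
  have := SCLAlgebra.eval_eq_of_tree_eq (TermModel A) h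
  rw [eval_termModel, eval_termModel] at this
  exact Quotient.exact this

end TermModel

/-! ## Completeness of free short-circuit logic -/

section Conditional

variable {A : Type u}

/-- The term over CP that represents an evaluation tree. -/
def Tree.toCP : Tree A → CP.Tm A
  | .leaf true => CP.tt
  | .leaf false => CP.ff
  | .node l a r => CP.cond l.toCP (Term.func (L := sigCP A) (CPSymbol.atom a) ![]) r.toCP

theorem CPNegConj.derivable_subst {s t : CP.Tm A} (h : CPNegConj A s t) (p q r p' q' : CP.Tm A) :
    Derivable (CPNegConj A) (s.subst (listSubst q' [p, q, r, p']))
      (t.subst (listSubst q' [p, q, r, p'])) :=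
  .subst _ (.ax h)

/-- CP4 pushes the outer conditional below the root atom of `X`; CP1 and CP2 resolve it at the
leaves. -/
theorem CPNegConj.cond_toCP (X Y Z : Tree A) :
    Derivable (CPNegConj A) (CP.cond Y.toCP X.toCP Z.toCP) (X.subst Y Z).toCP := by
  induction X with
  | leaf b =>
    cases b
    · have := CPNegConj.CP2.derivable_subst Y.toCP Z.toCP Z.toCP Z.toCP Z.toCP
      simp only [CP.cond_subst, CP.ff_subst] at this
      exact this
    · have := CPNegConj.CP1.derivable_subst Y.toCP Z.toCP Z.toCP Z.toCP Z.toCP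
      simp only [CP.cond_subst, CP.tt_subst] at this
      exact this
  | node l a r hl hr =>
    have := CPNegConj.CP4.derivable_subst Y.toCP l.toCP
      (Term.func (L := sigCP A) (CPSymbol.atom a) ![]) r.toCP Z.toCP
    simp only [CP.cond_subst] at this
    exact .trans this (CP.derivable_cond hl (.refl _) hr)

/-- The translation of closed statements that eliminates falsehood and disjunction. -/
def ClosedStatement.toVisible : ClosedStatement A → (sigVisible A).Term ℕ
  | .atom a => Term.func (L := sigVisible A) (VisibleSymbol.atom a) ![]
  | .tt => Term.func (L := sigVisible A) VisibleSymbol.tt ![]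
  | .ff => Term.func (L := sigVisible A) VisibleSymbol.neg
      ![Term.func (L := sigVisible A) VisibleSymbol.tt ![] ]
  | .neg P => Term.func (L := sigVisible A) VisibleSymbol.neg ![P.toVisible]
  | .conj P Q => Term.func (L := sigVisible A) VisibleSymbol.conj ![P.toVisible, Q.toVisible]
  | .disj P Q => Term.func (L := sigVisible A) VisibleSymbol.neg
      ![Term.func (L := sigVisible A) VisibleSymbol.conj
        ![Term.func (L := sigVisible A) VisibleSymbol.neg ![P.toVisible],
          Term.func (L := sigVisible A) VisibleSymbol.neg ![Q.toVisible] ] ]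

section

variable (s t : (sigVisible A).Term ℕ)

theorem visibleToSCL_tt :
    (visibleToSCL A).onTerm (Term.func (L := sigVisible A) VisibleSymbol.tt ![] : Term _ ℕ) =
      SCL.tt :=
  congrArg (Term.func _) (by ext i; exact i.elim0)

theorem visibleToSCL_atom (a : A) :
    (visibleToSCL A).onTerm
      (Term.func (L := sigVisible A) (VisibleSymbol.atom a) ![] : Term _ ℕ) = SCL.atom a :=
  congrArg (Term.func _) (by ext i; exact i.elim0)

theorem visibleToSCL_neg :
    (visibleToSCL A).onTerm (Term.func (L := sigVisible A) VisibleSymbol.neg ![s]) =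
      SCL.neg ((visibleToSCL A).onTerm s) :=
  congrArg (Term.func _) (funext (Fin.forall_fin_one.2 rfl))

theorem visibleToSCL_conj :
    (visibleToSCL A).onTerm (Term.func (L := sigVisible A) VisibleSymbol.conj ![s, t]) =
      SCL.conj ((visibleToSCL A).onTerm s) ((visibleToSCL A).onTerm t) :=
  congrArg (Term.func _) (funext (Fin.forall_fin_two.2 ⟨rfl, rfl⟩))

theorem visibleToCP_tt :
    (visibleToCP A).onTerm (Term.func (L := sigVisible A) VisibleSymbol.tt ![] : Term _ ℕ) =
      CP.tt :=
  congrArg (Term.func _) (by ext i; exact i.elim0)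

theorem visibleToCP_atom (a : A) :
    (visibleToCP A).onTerm
      (Term.func (L := sigVisible A) (VisibleSymbol.atom a) ![] : Term _ ℕ) =
      Term.func (L := sigCP A) (CPSymbol.atom a) ![] :=
  congrArg (Term.func _) (by ext i; exact i.elim0)

theorem visibleToCP_neg :
    (visibleToCP A).onTerm (Term.func (L := sigVisible A) VisibleSymbol.neg ![s]) =
      CP.neg ((visibleToCP A).onTerm s) :=
  congrArg (Term.func _) (funext (Fin.forall_fin_one.2 rfl))

theorem visibleToCP_conj :
    (visibleToCP A).onTerm (Term.func (L := sigVisible A) VisibleSymbol.conj ![s, t]) =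
      CP.conj ((visibleToCP A).onTerm s) ((visibleToCP A).onTerm t) :=
  congrArg (Term.func _) (funext (Fin.forall_fin_two.2 ⟨rfl, rfl⟩))

end

theorem CPNegConj.neg_toCP {s : CP.Tm A} {X : Tree A} (h : Derivable (CPNegConj A) s X.toCP) :
    Derivable (CPNegConj A) (CP.neg s) X.neg.toCP := by
  have := CPNegConj.defNeg.derivable_subst s s s s s
  simp only [CP.neg_subst, CP.cond_subst, CP.tt_subst, CP.ff_subst] at this
  exact .trans this (.trans (CP.derivable_cond (.refl _) h (.refl _))
    (cond_toCP X (.leaf false) (.leaf true)))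

theorem CPNegConj.conj_toCP {s t : CP.Tm A} {X Y : Tree A}
    (h : Derivable (CPNegConj A) s X.toCP) (h' : Derivable (CPNegConj A) t Y.toCP) :
    Derivable (CPNegConj A) (CP.conj s t) (X.and Y).toCP := by
  have := CPNegConj.defConj.derivable_subst s t s s s
  simp only [CP.conj_subst, CP.cond_subst, CP.ff_subst] at this
  exact .trans this (.trans (CP.derivable_cond h' h (.refl _)) (cond_toCP X Y (.leaf false)))

theorem CPNegConj.toVisible_toCP (P : ClosedStatement A) :
    Derivable (CPNegConj A) ((visibleToCP A).onTerm P.toVisible) P.tree.toCP := by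
  induction P with
  | atom a =>
    rw [ClosedStatement.toVisible, visibleToCP_atom]
    -- CP3, read from right to left, expands an atom into its one-node tree.
    have := Derivable.subst (fun _ => Term.func (L := sigCP A) (CPSymbol.atom a) ![])
      (.ax (CPNegConj.CP3 (A := A)))
    simp only [CP.cond_subst, CP.tt_subst, CP.ff_subst] at this
    exact this.symm
  | tt =>
    rw [ClosedStatement.toVisible, visibleToCP_tt]
    exact .refl _
  | ff =>
    rw [ClosedStatement.toVisible, visibleToCP_neg, visibleToCP_tt]
    exact neg_toCP (X := .leaf true) (.refl _)
  | neg P hP =>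
    rw [ClosedStatement.toVisible, visibleToCP_neg]
    exact neg_toCP hP
  | conj P Q hP hQ =>
    rw [ClosedStatement.toVisible, visibleToCP_conj]
    exact conj_toCP hP hQ
  | disj P Q hP hQ =>
    rw [ClosedStatement.toVisible, visibleToCP_neg, visibleToCP_conj, visibleToCP_neg,
      visibleToCP_neg]
    have := neg_toCP (conj_toCP (neg_toCP hP) (neg_toCP hQ))
    simpa [ClosedStatement.tree] using this

theorem FSCL.derivable_toVisible (P : ClosedStatement A) :
    Derivable (FSCL A) P.toTerm ((visibleToSCL A).onTerm P.toVisible) := by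
  induction P with
  | atom a =>
    rw [ClosedStatement.toVisible, visibleToSCL_atom]
    exact .refl _
  | tt =>
    rw [ClosedStatement.toVisible, visibleToSCL_tt]
    exact .refl _
  | ff =>
    rw [ClosedStatement.toVisible, visibleToSCL_neg, visibleToSCL_tt]
    exact .ax .defFalse
  | neg P hP =>
    rw [ClosedStatement.toVisible, visibleToSCL_neg]
    exact SCL.derivable_neg hP
  | conj P Q hP hQ =>
    rw [ClosedStatement.toVisible, visibleToSCL_conj]
    exact SCL.derivable_conj hP hQ
  | disj P Q hP hQ =>
    rw [ClosedStatement.toVisible, visibleToSCL_neg, visibleToSCL_conj, visibleToSCL_neg,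
      visibleToSCL_neg]
    have := Derivable.subst (listSubst Q.toTerm [P.toTerm]) (.ax (FSCL.defDisj (A := A)))
    simp only [SCL.neg_subst, SCL.conj_subst, SCL.disj_subst] at this
    exact .trans this (SCL.derivable_neg (SCL.derivable_conj (SCL.derivable_neg hP)
      (SCL.derivable_neg hQ)))

theorem FSCL.derivable_of_tree_eq {P Q : ClosedStatement A} (h : P.tree = Q.tree) :
    Derivable (FSCL A) P.toTerm Q.toTerm := by
  have hPQ : moduleSCL A P.toVisible Q.toVisible := by
    refine .trans (CPNegConj.toVisible_toCP P) ?_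
    rw [h]
    exact (CPNegConj.toVisible_toCP Q).symm
  exact .trans (derivable_toVisible P)
    (.trans (.ax (.ofModule hPQ)) (derivable_toVisible Q).symm)

end Conditional

end ShortCircuit

theorem theorem4p1 {A : Type*} [Nonempty A] (P Q : ShortCircuit.ClosedStatement A) :
    ShortCircuit.Derivable (ShortCircuit.EqFSCL A) P.toTerm Q.toTerm ↔
      ShortCircuit.Derivable (ShortCircuit.FSCL A) P.toTerm Q.toTerm :=
  ⟨fun h => ShortCircuit.FSCL.derivable_of_tree_eq
      (h.tree_eq fun _ _ => ShortCircuit.EqFSCL.realize_eq),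
    fun h => ShortCircuit.EqFSCL.derivable_of_tree_eq
      (h.tree_eq fun _ _ => ShortCircuit.FSCL.realize_eq)⟩
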